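/- Time is discrete, $t=0,1,2,\dots$, and every filtration $\mathbb{G}=(\mathcal{G}_t)_{t\ge 0}$ on a measurable space $(\Omega,\mathcal{F})$ is assumed to have a trivial initial $\sigma$-algebra, $\mathcal{G}_0=\{\emptyset,\Omega\}$. Processes take values in $[0,\infty]$. For a process $X$ put $X^*_t=\sup_{i\le t}X_i$ and, at infinite times, $X_\infty=\limsup_{t\to\infty}X_t$. A test supermartingale for a distribution $P$ in $\mathbb{G}$ is a $\mathbb{G}$-adapted process $M$ with $M_0=1$ and $\mathbb{E}_P[M_t\mid\mathcal{G}_{t-1}]\le M_{t-1}$ $P$-a.s. for all $t\ge1$. An e-process for a family $\mathcal{P}$ of distributions in $\mathbb{G}$ is a $\mathbb{G}$-adapted process $\mathfrak{e}$ with $\mathfrak{e}_0\le 1$ and $\mathbb{E}_P[\mathfrak{e}_\tau]\le1$ for every $\mathbb{G}$-stopping time $\tau$ with values in $\mathbb{N}\cup\{\infty\}$ and every $P\in\mathcal{P}$. Let $\mathsf{A}:[1,\infty]\to[0,\infty]$ be an increasing (i.e. nondecreasing) function, and read $\mathsf{A}(x)$ as $\mathsf{A}(1)$ for $x<1$. For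 an e-process $\mathfrak{e}$ define $\mathfrak{e}^{\mathsf{adj}}_0=1$ and $\mathfrak{e}^{\mathsf{adj}}_t=\mathsf{A}(\mathfrak{e}^*_t)$ for $t\ge1$. The following statements are equivalent. (a) $\int_1^\infty \frac{\mathsf{A}(x)}{x^2}\,dx\le 1$. (b) For every probability distribution $P$ (on any measurable space) and every test supermartingale $(M_t)$ for $P$ in some filtration $\mathbb{G}$, there is a test supermartingale $(M'_t)$ for $P$ in $\mathbb{G}$ such that $\mathsf{A}(M^*_t)\le M'_t$ $P$-a.s. for all $t\ge0$. (c) For every family $\mathcal{P}$ of distributions (on any measurable space) and every e-process $(\mathfrak{e}_t)$ for $\mathcal{P}$ in some filtration $\mathbb{G}$, there is an e-process $(\mathfrak{e}'_t)$ for $\mathcal{P}$ in $\mathbb{G}$ such that, for every $P\in\mathcal{P}$, $\mathsf{A}(\mathfrak{e}^*_t)\le\mathfrak{e}'_t$ $P$-a.s. for all $t\ge0$. (d) For every $\mathcal{P}$ and every e-process $(\mathfrak{e}_t)$ for $\mathcal{P}$ in some filtration $\mathbb{G}$, $(\mathfrak{e}^{\mathsf{adj}}_t)$ is an e-process for $\mathcal{P}$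 in $\mathbb{G}$. (e) For every $\mathcal{P}$, every e-process $(\mathfrak{e}_t)$ for $\mathcal{P}$ in some filtration $\mathbb{G}$, and every finer filtration $\mathbb{F}\supseteq\mathbb{G}$, $(\mathfrak{e}^{\mathsf{adj}}_t)$ is an e-process for $\mathcal{P}$ in $\mathbb{F}$. Furthermore, for each of the five properties (a)–(e), say that $\mathsf{A}$ is admissible for that property if $\mathsf{A}$ has the property and no other increasing function $\mathsf{B}:[1,\infty]\to[0,\infty]$ with the property satisfies $\mathsf{A}(x)\le\mathsf{B}(x)$ for all $x\in[1,\infty]$. Then, for each of the five properties, $\mathsf{A}$ is admissible for that property if and only if $\mathsf{A}$ is right-continuous, $\mathsf{A}(\infty)=\infty$, and $\int_1^\infty\frac{\mathsf{A}(x)}{x^2}\,dx=1$. -/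

import Mathlib

open MeasureTheory Filter
open scoped ENNReal

universe u

noncomputable section

namespace Adjuster

section Processes

variable {Ω : Type u} {mΩ : MeasurableSpace Ω}

/-- The value `X_τ` of a `[0, ∞]`-valued process at a random time `τ` with values in
`ℕ ∪ {∞}`, with the convention `X_∞ = limsup_t X_t`. -/
def valueAt (X : ℕ → Ω → ℝ≥0∞) (τ : Ω → WithTop ℕ) (ω : Ω) : ℝ≥0∞ :=
  match τ ω with
  | ⊤ => limsup (fun t => X t ω) atTop
  | (t : ℕ) => X t ω

/-- The running maximum `X*_t = sup_{i ≤ t} X_i`. -/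
def runningMax (X : ℕ → Ω → ℝ≥0∞) (t : ℕ) (ω : Ω) : ℝ≥0∞ :=
  ⨆ i ≤ t, X i ω

/-- A test supermartingale for the distribution `P` in the filtration `G`: an adapted
`[0, ∞]`-valued process with `M_0 = 1` and `E_P[M_t | G_{t-1}] ≤ M_{t-1}` almost surely for all
`t ≥ 1`; the conditional expectation is the one of `[0, ∞]`-valued random variables. -/
structure IsTestSupermartingale (P : ProbabilityMeasure Ω) (G : Filtration ℕ mΩ)
    (M : ℕ → Ω → ℝ≥0∞) : Prop where
  adapted : Adapted G M
  zero : ∀ ω, M 0 ω = 1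
  condLExp_le : ∀ t : ℕ, condLExp (G t) (P : Measure Ω) (M (t + 1)) ≤ᵐ[(P : Measure Ω)] M t

/-- An e-process for the family of distributions `H` in the filtration `G`: an adapted
`[0, ∞]`-valued process with `e_0 ≤ 1` and `E_P[e_τ] ≤ 1` for every `G`-stopping time `τ`
(with values in `ℕ ∪ {∞}`) and every `P ∈ H`. -/
structure IsEProcess (H : Set (ProbabilityMeasure Ω)) (G : Filtration ℕ mΩ)
    (e : ℕ → Ω → ℝ≥0∞) : Prop where
  adapted : Adapted G e
  zero_le_one : ∀ ω, e 0 ω ≤ 1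
  lintegral_le_one : ∀ τ : Ω → WithTop ℕ, IsStoppingTime G τ →
    ∀ P ∈ H, ∫⁻ ω, valueAt e τ ω ∂(P : Measure Ω) ≤ 1

/-- The value `A(x)` of a function on `[1, ∞]` at `x ∈ [0, ∞]`, read as `A(max(1, x))`. -/
def evalAt (A : Set.Ici (1 : ℝ≥0∞) → ℝ≥0∞) (x : ℝ≥0∞) : ℝ≥0∞ :=
  A (Set.projIci 1 x)

/-- The adjusted process: `1` at time `0` and `A(e*_t)` at every time `t ≥ 1`. -/
def adjusted (A : Set.Ici (1 : ℝ≥0∞) → ℝ≥0∞) (e : ℕ → Ω → ℝ≥0∞) (t : ℕ) (ω : Ω) : ℝ≥0∞ :=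
  if t = 0 then 1 else evalAt A (runningMax e t ω)

end Processes

/-- The integral `∫_1^∞ A(x) / x² dx`, with values in `[0, ∞]`. -/
def adjusterIntegral (A : Set.Ici (1 : ℝ≥0∞) → ℝ≥0∞) : ℝ≥0∞ :=
  ∫⁻ x in Set.Ici (1 : ℝ), evalAt A (ENNReal.ofReal x) / ENNReal.ofReal (x ^ 2)

/-- The integral condition. -/
def IsAdjuster (A : Set.Ici (1 : ℝ≥0∞) → ℝ≥0∞) : Prop :=
  adjusterIntegral A ≤ 1

/-- Adjuster for test supermartingales: for every distribution `P` and every test supermartingale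
`M` for `P` in some filtration `G`, the process `A(M*_t)` is bounded above, `P`-almost surely, by a
test supermartingale for `P` in `G`. -/
def IsAdjusterForTestSupermartingales (A : Set.Ici (1 : ℝ≥0∞) → ℝ≥0∞) : Prop :=
  ∀ (Ω : Type u) (mΩ : MeasurableSpace Ω) (P : ProbabilityMeasure Ω)
    (G : Filtration ℕ mΩ), G 0 = ⊥ →
    ∀ M : ℕ → Ω → ℝ≥0∞, IsTestSupermartingale P G M →
      ∃ M' : ℕ → Ω → ℝ≥0∞, IsTestSupermartingale P G M' ∧
        ∀ t, ∀ᵐ ω ∂(P : Measure Ω), evalAt A (runningMax M t ω) ≤ M' t ω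

/-- Adjuster for e-processes: for every family `H` and every e-process `e` for `H` in some
filtration `G`, the process `A(e*_t)` is bounded above, `P`-almost surely for every `P ∈ H`, by an
e-process for `H` in `G`. -/
def IsAdjusterForEProcesses (A : Set.Ici (1 : ℝ≥0∞) → ℝ≥0∞) : Prop :=
  ∀ (Ω : Type u) (mΩ : MeasurableSpace Ω) (H : Set (ProbabilityMeasure Ω))
    (G : Filtration ℕ mΩ), G 0 = ⊥ →
    ∀ e : ℕ → Ω → ℝ≥0∞, IsEProcess H G e →
      ∃ e' : ℕ → Ω → ℝ≥0∞, IsEProcess H G e' ∧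
        ∀ P ∈ H, ∀ t, ∀ᵐ ω ∂(P : Measure Ω), evalAt A (runningMax e t ω) ≤ e' t ω

/-- The adjusted process of every e-process in a filtration `G` is an e-process in `G`. -/
def PreservesEProcesses (A : Set.Ici (1 : ℝ≥0∞) → ℝ≥0∞) : Prop :=
  ∀ (Ω : Type u) (mΩ : MeasurableSpace Ω) (H : Set (ProbabilityMeasure Ω))
    (G : Filtration ℕ mΩ), G 0 = ⊥ →
    ∀ e : ℕ → Ω → ℝ≥0∞, IsEProcess H G e → IsEProcess H G (adjusted A e)

/-- e-lifting: the adjusted process of every e-process in a filtration `G` is an e-process in every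
finer filtration `F`. -/
def LiftsEProcesses (A : Set.Ici (1 : ℝ≥0∞) → ℝ≥0∞) : Prop :=
  ∀ (Ω : Type u) (mΩ : MeasurableSpace Ω) (H : Set (ProbabilityMeasure Ω))
    (G : Filtration ℕ mΩ), G 0 = ⊥ →
    ∀ e : ℕ → Ω → ℝ≥0∞, IsEProcess H G e →
      ∀ F : Filtration ℕ mΩ, F 0 = ⊥ → G ≤ F → IsEProcess H F (adjusted A e)

/-- Admissibility with respect to a property `Q` of functions `[1, ∞] → [0, ∞]`: `A` is an
increasing function with `Q` and no other increasing function with `Q` dominates it on `[1, ∞]`. -/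
def IsAdmissible (Q : (Set.Ici (1 : ℝ≥0∞) → ℝ≥0∞) → Prop)
    (A : Set.Ici (1 : ℝ≥0∞) → ℝ≥0∞) : Prop :=
  Monotone A ∧ Q A ∧
    ∀ B : Set.Ici (1 : ℝ≥0∞) → ℝ≥0∞, Monotone B → Q B → (∀ x, A x ≤ B x) → B = A

end Adjuster

end

namespace Adjuster

/-! The density `1 / x²` on `[1, ∞)` has tail `1 / c`, the largest tail that Ville's inequality
allows for the supremum of a test supermartingale or an e-process. By the layer cake formula, an
increasing `A` of that supremum has expectation at most `∫ A(x) / x² dx`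
(`lintegral_evalAt_le_adjusterIntegral`). Under (a), the single random variable `A(sup e)` therefore
has expectation at most 1. It dominates the adjusted process at all positive times at once, whatever
the filtration, which gives (e), hence (d) and (c). Its conditional expectations form the
supermartingale of (b). Conversely, a gambler who stakes everything on fair bets won with
probability `q` reaches the maximum `q⁻ᵏ` with probability `qᵏ (1 - q)`. Either (b) or (c) then
bounds a Riemann sum of the integral by 1, up to a factor that tends to 1 as `q → 1`. For
admissibility, the integral ignores countable sets. A maximal `A` thus equals its right limits and
is `∞` at `∞`, and adding the missing constant shows that its integral is 1. In the other direction,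
a dominating `B` agrees with `A` almost everywhere, and right-continuity makes them equal. -/

/-! ### Layer cake formula and the extremal law `dx / x²` -/

theorem volume_setOf_ofReal_lt (y : ℝ≥0∞) :
    volume {s : ℝ | s ∈ Set.Ioi 0 ∧ ENNReal.ofReal s < y} = y := by
  rcases eq_or_ne y ⊤ with rfl | hy
  · have : {s : ℝ | s ∈ Set.Ioi 0 ∧ ENNReal.ofReal s < ⊤} = Set.Ioi 0 := by ext; simp
    rw [this, Real.volume_Ioi]
  · have : {s : ℝ | s ∈ Set.Ioi 0 ∧ ENNReal.ofReal s < y} = Set.Ioo 0 y.toReal := by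
      ext s
      simp only [Set.mem_ofPred_eq, Set.mem_Ioi, Set.mem_Ioo, and_congr_right_iff]
      intro hs
      rw [ENNReal.ofReal_lt_iff_lt_toReal hs.le hy]
    rw [this, Real.volume_Ioo, sub_zero, ENNReal.ofReal_toReal hy]

/-- Layer cake representation of the integral of a `[0, ∞]`-valued function. -/
theorem lintegral_eq_lintegral_measure_setOf_lt {α : Type*} [MeasurableSpace α] (μ : Measure α)
    [SFinite μ] {f : α → ℝ≥0∞} (hf : Measurable f) :
    ∫⁻ x, f x ∂μ = ∫⁻ s in Set.Ioi (0 : ℝ), μ {x | ENNReal.ofReal s < f x} := by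
  have h1 (x : α) : f x = ∫⁻ s in Set.Ioi (0 : ℝ),
      {p : α × ℝ | ENNReal.ofReal p.2 < f p.1}.indicator 1 (x, s) := by
    have hm : MeasurableSet {s : ℝ | ENNReal.ofReal s < f x} :=
      measurableSet_lt ENNReal.measurable_ofReal measurable_const
    have : (fun s : ℝ => {p : α × ℝ | ENNReal.ofReal p.2 < f p.1}.indicator (1 : α × ℝ → ℝ≥0∞)
        (x, s)) = {s : ℝ | ENNReal.ofReal s < f x}.indicator 1 := rfl
    rw [this, lintegral_indicator_one hm, Measure.restrict_apply hm, Set.inter_comm]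
    exact (volume_setOf_ofReal_lt (f x)).symm
  have hM : MeasurableSet {p : α × ℝ | ENNReal.ofReal p.2 < f p.1} :=
    measurableSet_lt (ENNReal.measurable_ofReal.comp measurable_snd) (hf.comp measurable_fst)
  calc ∫⁻ x, f x ∂μ = ∫⁻ x, (∫⁻ s in Set.Ioi (0 : ℝ),
        {p : α × ℝ | ENNReal.ofReal p.2 < f p.1}.indicator 1 (x, s)) ∂μ := by simp_rw [← h1]
    _ = ∫⁻ s in Set.Ioi (0 : ℝ), (∫⁻ x,
        {p : α × ℝ | ENNReal.ofReal p.2 < f p.1}.indicator 1 (x, s) ∂μ) := by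
      refine lintegral_lintegral_swap (Measurable.aemeasurable ?_)
      exact measurable_one.indicator hM
    _ = _ := by
      refine lintegral_congr fun s => ?_
      exact lintegral_indicator_one
        (measurableSet_lt (f := fun _ => ENNReal.ofReal s) measurable_const hf)

theorem lintegral_Ioi_inv_sq {c : ℝ} (hc : 0 < c) :
    ∫⁻ x in Set.Ioi c, (ENNReal.ofReal (x ^ 2))⁻¹ = (ENNReal.ofReal c)⁻¹ := by
  have h : ∫⁻ x in Set.Ioi c, (ENNReal.ofReal (x ^ 2))⁻¹
      = ∫⁻ x in Set.Ioi c, ENNReal.ofReal (x ^ (-2 : ℝ)) := by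
    refine setLIntegral_congr_fun measurableSet_Ioi fun x hx => ?_
    have hx0 : 0 < x := hc.trans hx
    rw [← ENNReal.ofReal_inv_of_pos (by positivity), Real.rpow_neg hx0.le]
    norm_num
  rw [h, ← ofReal_integral_eq_lintegral_ofReal
    (integrableOn_Ioi_rpow_of_lt (by norm_num) hc), integral_Ioi_rpow_of_lt (by norm_num) hc,
    ← ENNReal.ofReal_inv_of_pos hc]
  · norm_num [Real.rpow_neg hc.le]
  · filter_upwards [ae_restrict_mem measurableSet_Ioi] with x hx
    exact Real.rpow_nonneg (hc.trans hx).le _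

theorem monotone_evalAt {A : Set.Ici (1 : ℝ≥0∞) → ℝ≥0∞} (hA : Monotone A) :
    Monotone (evalAt A) :=
  hA.comp Set.monotone_projIci

theorem measurable_evalAt {A : Set.Ici (1 : ℝ≥0∞) → ℝ≥0∞} (hA : Monotone A) :
    Measurable (evalAt A) :=
  (monotone_evalAt hA).measurable

/-- The measure on `[1, ∞)` with density `1 / x²`. -/
noncomputable def invSqMeasure : Measure ℝ :=
  (volume.restrict (Set.Ici 1)).withDensity fun x => (ENNReal.ofReal (x ^ 2))⁻¹

theorem invSqMeasure_Ioi {c : ℝ} (hc : 1 ≤ c) :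
    invSqMeasure (Set.Ioi c) = (ENNReal.ofReal c)⁻¹ := by
  rw [invSqMeasure, withDensity_apply _ measurableSet_Ioi,
    Measure.restrict_restrict measurableSet_Ioi,
    Set.inter_eq_left.2 (Set.Ioi_subset_Ici hc)]
  exact lintegral_Ioi_inv_sq (by linarith)

theorem measurable_evalAt_ofReal {A : Set.Ici (1 : ℝ≥0∞) → ℝ≥0∞} (hA : Monotone A) :
    Measurable fun x : ℝ => evalAt A (ENNReal.ofReal x) :=
  (measurable_evalAt hA).comp ENNReal.measurable_ofReal

theorem measurable_inv_sq : Measurable fun x : ℝ => (ENNReal.ofReal (x ^ 2))⁻¹ := by fun_prop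

theorem adjusterIntegral_eq_lintegral_invSqMeasure {A : Set.Ici (1 : ℝ≥0∞) → ℝ≥0∞}
    (hA : Monotone A) :
    adjusterIntegral A = ∫⁻ x, evalAt A (ENNReal.ofReal x) ∂invSqMeasure := by
  rw [invSqMeasure, lintegral_withDensity_eq_lintegral_mul _ measurable_inv_sq
    (measurable_evalAt_ofReal hA)]
  refine lintegral_congr fun x => ?_
  rw [Pi.mul_apply, mul_comm, div_eq_mul_inv]

instance : SFinite invSqMeasure := by
  unfold invSqMeasure
  infer_instance

/-- A monotone function of a random variable with the Markov tail bound has expectation at most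
the adjuster integral. -/
theorem lintegral_evalAt_le_adjusterIntegral {Ω : Type*} {mΩ : MeasurableSpace Ω} {P : Measure Ω}
    [IsProbabilityMeasure P] {A : Set.Ici (1 : ℝ≥0∞) → ℝ≥0∞} (hA : Monotone A) {Z : Ω → ℝ≥0∞}
    (hZ : Measurable Z) (htail : ∀ c, P {ω | c ≤ Z ω} ≤ c⁻¹) :
    ∫⁻ ω, evalAt A (Z ω) ∂P ≤ adjusterIntegral A := by
  rw [adjusterIntegral_eq_lintegral_invSqMeasure hA,
    lintegral_eq_lintegral_measure_setOf_lt P (f := fun ω => evalAt A (Z ω))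
      ((measurable_evalAt hA).comp hZ),
    lintegral_eq_lintegral_measure_setOf_lt invSqMeasure (measurable_evalAt_ofReal hA)]
  refine lintegral_mono fun s => ?_
  -- Below the level `A(1)` the superlevel set is everything, and both measures have total mass 1.
  by_cases h1 : ENNReal.ofReal s < evalAt A 1
  · calc P {ω | ENNReal.ofReal s < evalAt A (Z ω)} ≤ 1 := prob_le_one
      _ = invSqMeasure (Set.Ioi 1) := by rw [invSqMeasure_Ioi le_rfl]; simp
      _ ≤ _ := measure_mono fun x hx => h1.trans_le (monotone_evalAt hA (by
          simpa using (le_of_lt hx : (1 : ℝ) ≤ x)))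
  -- `U` is an up-set, which may or may not contain its infimum. It lies in the closed half-line,
  -- where the tail bound applies, and contains the open one, whose `invSqMeasure` attains that
  -- bound.
  set U : Set ℝ≥0∞ := {z | ENNReal.ofReal s < evalAt A z}
  have hU1 : 1 ≤ sInf U := le_sInf fun z hz => le_of_not_gt fun hz1 =>
    h1 (lt_of_lt_of_le hz (monotone_evalAt hA hz1.le))
  calc P {ω | ENNReal.ofReal s < evalAt A (Z ω)} ≤ P {ω | sInf U ≤ Z ω} :=
        measure_mono fun ω (hω : Z ω ∈ U) => show sInf U ≤ Z ω from sInf_le hω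
    _ ≤ (sInf U)⁻¹ := htail _
    _ ≤ invSqMeasure {x | ENNReal.ofReal s < evalAt A (ENNReal.ofReal x)} := by
      rcases eq_or_ne (sInf U) ⊤ with htop | htop
      · simp [htop]
      have h1r : 1 ≤ (sInf U).toReal := by
        simpa using ENNReal.toReal_mono htop hU1
      rw [← ENNReal.ofReal_toReal htop, ← invSqMeasure_Ioi h1r]
      refine measure_mono fun x (hx : _ < x) => ?_
      have : sInf U < ENNReal.ofReal x := by
        rwa [ENNReal.lt_ofReal_iff_toReal_lt htop]
      obtain ⟨z, hz, hzx⟩ := sInf_lt_iff.1 this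
      exact lt_of_lt_of_le hz (monotone_evalAt hA hzx.le)

/-! ### Ville's inequality and optional sampling -/

section Ville

variable {Ω : Type*} {mΩ : MeasurableSpace Ω}

/-- Ville's inequality for an adapted process whose stopped values have expectation at most one. -/
theorem measure_le_iSup_le_inv {P : Measure Ω} {G : Filtration ℕ mΩ} {X : ℕ → Ω → ℝ≥0∞}
    (hX : Adapted G X)
    (hstopped : ∀ τ : Ω → WithTop ℕ, IsStoppingTime G τ →
      ∀ n, ∫⁻ ω, stoppedProcess X τ n ω ∂P ≤ 1)
    (c : ℝ≥0∞) : P {ω | c ≤ ⨆ t, X t ω} ≤ c⁻¹ := by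
  have key (d : ℝ≥0∞) (n : ℕ) : d * P {ω | ∃ t ≤ n, d < X t ω} ≤ 1 := by
    have hτ : IsStoppingTime G (hittingAfter X (Set.Ioi d) 0) :=
      hX.isStoppingTime_hittingAfter measurableSet_Ioi
    have hset : {ω | ∃ t ≤ n, d < X t ω}
        = {ω | hittingAfter X (Set.Ioi d) 0 ω ≤ WithTop.some n} := by
      ext ω
      rw [Set.mem_ofPred_eq, Set.mem_ofPred_eq, hittingAfter_le_iff]
      simp
    have hs : MeasurableSet {ω | ∃ t ≤ n, d < X t ω} := hset ▸ G.le n _ (hτ n)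
    calc d * P {ω | ∃ t ≤ n, d < X t ω}
        = ∫⁻ _ in {ω | ∃ t ≤ n, d < X t ω}, d ∂P := (setLIntegral_const _ _).symm
      _ ≤ ∫⁻ ω in {ω | ∃ t ≤ n, d < X t ω},
          stoppedProcess X (hittingAfter X (Set.Ioi d) 0) n ω ∂P := by
        refine setLIntegral_mono' hs fun ω hω => ?_
        have hle : hittingAfter X (Set.Ioi d) 0 ω ≤ WithTop.some n := by
          have : ω ∈ {ω | hittingAfter X (Set.Ioi d) 0 ω ≤ WithTop.some n} := hset ▸ hω
          exact this
        rw [stoppedProcess_eq_of_ge hle]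
        refine le_of_lt (hittingAfter_mem_set_of_ne_top (u := X) (s := Set.Ioi d) (n := 0) ?_)
        exact ne_top_of_le_ne_top (WithTop.coe_ne_top) hle
      _ ≤ ∫⁻ ω, stoppedProcess X (hittingAfter X (Set.Ioi d) 0) n ω ∂P :=
        setLIntegral_le_lintegral _ _
      _ ≤ 1 := hstopped _ hτ n
  refine le_of_not_gt fun hlt => ?_
  -- The supremum may equal `c` without being attained. A strictly smaller level `d` is exceeded at
  -- some finite time, and `d` is close enough to `c` that `d⁻¹` is still below the assumed
  -- probability.
  obtain ⟨d, hd, hdc⟩ := exists_between (ENNReal.inv_lt_iff_inv_lt.1 hlt)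
  have hd0 : d ≠ 0 := (pos_of_gt hd).ne'
  have hdt : d ≠ ⊤ := hdc.ne_top
  have hunion : {ω | c ≤ ⨆ t, X t ω} ⊆ ⋃ n : ℕ, {ω | ∃ t ≤ n, d < X t ω} := by
    intro ω hω
    obtain ⟨t, ht⟩ := lt_iSup_iff.1 (hdc.trans_le hω)
    exact Set.mem_iUnion.2 ⟨t, t, le_rfl, ht⟩
  have hmono : Monotone fun n : ℕ => {ω | ∃ t ≤ n, d < X t ω} :=
    fun m n hmn ω ⟨t, ht, h⟩ => ⟨t, ht.trans hmn, h⟩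
  have : P {ω | c ≤ ⨆ t, X t ω} ≤ d⁻¹ := by
    refine (measure_mono hunion).trans ?_
    rw [hmono.measure_iUnion]
    refine iSup_le fun n => ?_
    rw [ENNReal.le_inv_iff_mul_le, mul_comm]
    exact key d n
  exact (this.trans_lt (ENNReal.inv_lt_iff_inv_lt.1 hd)).false

theorem stoppedProcess_eq_valueAt (X : ℕ → Ω → ℝ≥0∞) (τ : Ω → WithTop ℕ) (n : ℕ) :
    stoppedProcess X τ n = valueAt X fun ω => min (WithTop.some n) (τ ω) := by
  ext ω
  have : min (WithTop.some n) (τ ω) ≠ ⊤ := (min_lt_of_left_lt (WithTop.coe_lt_top n)).ne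
  obtain ⟨k, hk⟩ := WithTop.ne_top_iff_exists.1 this
  simp only [stoppedProcess, valueAt]
  rw [← hk]
  rfl

theorem IsEProcess.lintegral_stoppedProcess_le_one {H : Set (ProbabilityMeasure Ω)}
    {G : Filtration ℕ mΩ} {e : ℕ → Ω → ℝ≥0∞} (he : IsEProcess H G e) {P : ProbabilityMeasure Ω}
    (hP : P ∈ H) {τ : Ω → WithTop ℕ} (hτ : IsStoppingTime G τ) (n : ℕ) :
    ∫⁻ ω, stoppedProcess e τ n ω ∂(P : Measure Ω) ≤ 1 := by
  rw [stoppedProcess_eq_valueAt]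
  exact he.lintegral_le_one _ ((isStoppingTime_const G n).min hτ) P hP

theorem condLExp_le_iff {P : Measure Ω} [IsProbabilityMeasure P] {m : MeasurableSpace Ω}
    (hm : m ≤ mΩ) {X Y : Ω → ℝ≥0∞} (hY : Measurable[m] Y) :
    condLExp m P X ≤ᵐ[P] Y ↔
      ∀ s, MeasurableSet[m] s → ∫⁻ ω in s, X ω ∂P ≤ ∫⁻ ω in s, Y ω ∂P := by
  refine ⟨fun h s hs => ?_, fun h => ?_⟩
  · rw [← setLIntegral_condLExp hm P X hs]
    exact lintegral_mono_ae (ae_restrict_of_ae h)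
  -- Both sides are `m`-measurable, so they can be compared under the measure trimmed to `m`, where
  -- integrals over `m`-measurable sets decide.
  · apply ae_le_of_ae_le_trim (hm := hm)
    apply ae_le_of_forall_setLIntegral_le_of_sigmaFinite (measurable_condLExp m P X)
    intro s hs _
    rw [setLIntegral_condLExp_trim hm _ _ hs, setLIntegral_trim hm hY hs]
    exact h s hs

/-- Optional sampling at bounded times. -/
theorem IsTestSupermartingale.lintegral_stoppedProcess_le_one {P : ProbabilityMeasure Ω}
    {G : Filtration ℕ mΩ} {M : ℕ → Ω → ℝ≥0∞} (hM : IsTestSupermartingale P G M)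
    {τ : Ω → WithTop ℕ} (hτ : IsStoppingTime G τ) (n : ℕ) :
    ∫⁻ ω, stoppedProcess M τ n ω ∂(P : Measure Ω) ≤ 1 := by
  induction n with
  | zero =>
    have (ω : Ω) : stoppedProcess M τ 0 ω = 1 := by
      rw [stoppedProcess_eq_of_le bot_le, hM.zero]
    simp [this]
  | succ n ih =>
    refine le_trans ?_ ih
    have hs : MeasurableSet {ω | τ ω ≤ WithTop.some n} := G.le n _ (hτ n)
    -- On `{τ ≤ n}` the stopped process is frozen; the complement is an event of `G n`, so the
    -- supermartingale inequality can be integrated over it.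
    rw [← lintegral_add_compl _ hs, ← lintegral_add_compl (stoppedProcess M τ n) hs]
    refine add_le_add (le_of_eq ?_) ?_
    · refine setLIntegral_congr_fun hs fun ω (hω : τ ω ≤ WithTop.some n) => ?_
      rw [stoppedProcess_eq_of_ge hω,
        stoppedProcess_eq_of_ge (hω.trans (WithTop.coe_le_coe.2 n.le_succ))]
    · calc ∫⁻ ω in {ω | τ ω ≤ WithTop.some n}ᶜ, stoppedProcess M τ (n + 1) ω ∂(P : Measure Ω)
          = ∫⁻ ω in {ω | τ ω ≤ WithTop.some n}ᶜ, M (n + 1) ω ∂(P : Measure Ω) := by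
            refine setLIntegral_congr_fun hs.compl fun ω hω => ?_
            have hω' : WithTop.some n < τ ω := not_le.1 hω
            exact stoppedProcess_eq_of_le (by
              cases h : τ ω with
              | top => exact le_top
              | coe k => rw [h] at hω'; exact WithTop.coe_le_coe.2 (WithTop.coe_lt_coe.1 hω'))
        _ ≤ ∫⁻ ω in {ω | τ ω ≤ WithTop.some n}ᶜ, M n ω ∂(P : Measure Ω) :=
            (condLExp_le_iff (G.le n) (hM.adapted n)).1 (hM.condLExp_le n) _ (hτ n).compl
        _ = ∫⁻ ω in {ω | τ ω ≤ WithTop.some n}ᶜ, stoppedProcess M τ n ω ∂(P : Measure Ω) := by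
            refine setLIntegral_congr_fun hs.compl fun ω hω => ?_
            exact (stoppedProcess_eq_of_le (not_le.1 (show ¬ τ ω ≤ WithTop.some n from hω)).le).symm

end Ville

/-! ### Adjusted processes and closed supermartingales -/

section Processes

variable {Ω : Type*} {mΩ : MeasurableSpace Ω}

theorem runningMax_le_iSup (X : ℕ → Ω → ℝ≥0∞) (t : ℕ) (ω : Ω) :
    runningMax X t ω ≤ ⨆ i, X i ω :=
  iSup₂_le fun i _ => le_iSup (fun i => X i ω) i

theorem runningMax_zero (X : ℕ → Ω → ℝ≥0∞) (ω : Ω) : runningMax X 0 ω = X 0 ω := by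
  simp [runningMax]

theorem evalAt_of_le_one (A : Set.Ici (1 : ℝ≥0∞) → ℝ≥0∞) {x : ℝ≥0∞} (hx : x ≤ 1) :
    evalAt A x = evalAt A 1 :=
  congrArg A ((Set.projIci_of_le hx).trans (Set.projIci_of_le le_rfl).symm)

theorem evalAt_coe (A : Set.Ici (1 : ℝ≥0∞) → ℝ≥0∞) (x : Set.Ici (1 : ℝ≥0∞)) :
    evalAt A x = A x :=
  congrArg A (Set.projIci_coe x)

theorem _root_.MeasureTheory.Adapted.runningMax {G : Filtration ℕ mΩ} {X : ℕ → Ω → ℝ≥0∞}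
    (hX : Adapted G X) : Adapted G (runningMax X) := fun t =>
  Measurable.iSup fun i => Measurable.iSup fun hi : i ≤ t => (hX i).mono (G.mono hi) le_rfl

theorem _root_.MeasureTheory.Adapted.measurable_iSup {G : Filtration ℕ mΩ} {X : ℕ → Ω → ℝ≥0∞}
    (hX : Adapted G X) : Measurable fun ω => ⨆ i, X i ω :=
  Measurable.iSup fun i => (hX i).mono (G.le i) le_rfl

theorem adapted_adjusted {A : Set.Ici (1 : ℝ≥0∞) → ℝ≥0∞} (hA : Monotone A)
    {G : Filtration ℕ mΩ} {X : ℕ → Ω → ℝ≥0∞} (hX : Adapted G X) : Adapted G (adjusted A X) := by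
  intro t
  by_cases ht : t = 0
  · have : adjusted A X t = fun _ => 1 := funext fun ω => if_pos ht
    exact this ▸ measurable_const
  · have : adjusted A X t = fun ω => evalAt A (runningMax X t ω) := funext fun ω => if_neg ht
    exact this ▸ (measurable_evalAt hA).comp (hX.runningMax t)

/-- The constant 1 satisfies the Markov tail bound. This settles time 0 in (b). -/
theorem evalAt_one_le_adjusterIntegral {A : Set.Ici (1 : ℝ≥0∞) → ℝ≥0∞} (hA : Monotone A) :
    evalAt A 1 ≤ adjusterIntegral A := by
  have h := lintegral_evalAt_le_adjusterIntegral (P := Measure.dirac ()) hA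
    (Z := fun _ => 1) measurable_const (fun c => ?_)
  · simpa using h
  · by_cases hc : c ≤ 1
    · exact prob_le_one.trans (ENNReal.one_le_inv.2 hc)
    · simp [hc]

/-- The bound depends neither on `τ` nor on a filtration. Time 0 is excluded because the adjusted
process is 1 there, which may exceed `A` of the supremum. -/
theorem valueAt_adjusted_le {A : Set.Ici (1 : ℝ≥0∞) → ℝ≥0∞} (hA : Monotone A)
    (X : ℕ → Ω → ℝ≥0∞) {τ : Ω → WithTop ℕ} {ω : Ω} (hτ : τ ω ≠ 0) :
    valueAt (adjusted A X) τ ω ≤ evalAt A (⨆ i, X i ω) := by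
  have h (t : ℕ) (ht : t ≠ 0) : adjusted A X t ω ≤ evalAt A (⨆ i, X i ω) := by
    rw [adjusted, if_neg ht]
    exact monotone_evalAt hA (runningMax_le_iSup X t ω)
  simp only [valueAt]
  cases hω : τ ω with
  | top =>
    refine limsup_le_of_le (by isBoundedDefault) ?_
    filter_upwards [eventually_ne_atTop 0] with t ht using h t ht
  | coe t =>
    refine h t fun ht => hτ ?_
    rw [hω, ht]
    rfl

theorem IsEProcess.lintegral_evalAt_iSup_le {A : Set.Ici (1 : ℝ≥0∞) → ℝ≥0∞} (hA : Monotone A)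
    {H : Set (ProbabilityMeasure Ω)} {G : Filtration ℕ mΩ} {e : ℕ → Ω → ℝ≥0∞}
    (he : IsEProcess H G e) {P : ProbabilityMeasure Ω} (hP : P ∈ H) :
    ∫⁻ ω, evalAt A (⨆ i, e i ω) ∂(P : Measure Ω) ≤ adjusterIntegral A :=
  lintegral_evalAt_le_adjusterIntegral hA he.adapted.measurable_iSup
    (measure_le_iSup_le_inv he.adapted fun _ hτ n => he.lintegral_stoppedProcess_le_one hP hτ n)

theorem IsTestSupermartingale.lintegral_evalAt_iSup_le {A : Set.Ici (1 : ℝ≥0∞) → ℝ≥0∞}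
    (hA : Monotone A) {P : ProbabilityMeasure Ω} {G : Filtration ℕ mΩ} {M : ℕ → Ω → ℝ≥0∞}
    (hM : IsTestSupermartingale P G M) :
    ∫⁻ ω, evalAt A (⨆ i, M i ω) ∂(P : Measure Ω) ≤ adjusterIntegral A :=
  lintegral_evalAt_le_adjusterIntegral hA hM.adapted.measurable_iSup
    (measure_le_iSup_le_inv hM.adapted fun _ hτ n => hM.lintegral_stoppedProcess_le_one hτ n)

/-- A nonnegative random variable of expectation at most one closes a test supermartingale. -/
theorem isTestSupermartingale_condLExp {P : ProbabilityMeasure Ω} {G : Filtration ℕ mΩ}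
    (hG : G 0 = ⊥) {Z : Ω → ℝ≥0∞} (hZ : ∫⁻ ω, Z ω ∂(P : Measure Ω) ≤ 1) :
    IsTestSupermartingale P G
      fun t ω => if t = 0 then 1 else condLExp (G t) (P : Measure Ω) Z ω where
  adapted t := by
    by_cases ht : t = 0
    · simp only [ht, if_true]
      exact measurable_const
    · simp only [ht, if_false]
      exact measurable_condLExp _ _ _
  zero ω := by simp
  condLExp_le t := by
    simp only [Nat.add_eq_zero_iff, one_ne_zero, and_false, if_false]
    by_cases ht : t = 0
    · subst ht
      simp only [if_true]
      -- As `G 0` is trivial, conditioning on it gives the constant `∫ Z`, which is at most the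
      -- prescribed initial value 1.
      rw [hG, condLExp_bot, lintegral_condLExp (G.le _)]
      exact ae_of_all _ fun _ => hZ
    · simp only [ht, if_false]
      rw [condLExp_le_iff (G.le t) (measurable_condLExp _ _ _)]
      intro s hs
      rw [setLIntegral_condLExp (G.le t) _ _ hs,
        setLIntegral_condLExp (G.le (t + 1)) _ _ (G.mono t.le_succ _ hs)]

end Processes

/-! ### Sufficiency of the integral condition -/

/-- Stopping times of `G` alone control the law of the supremum of `e`, and that law does not change
when the filtration is refined. -/
theorem IsAdjuster.liftsEProcesses {A : Set.Ici (1 : ℝ≥0∞) → ℝ≥0∞} (hA : Monotone A)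
    (h : IsAdjuster A) : LiftsEProcesses.{u} A := by
  intro Ω mΩ H G _ e he F hF hGF
  have hF' : Adapted F e := fun t => (he.adapted t).mono (hGF t) le_rfl
  refine ⟨adapted_adjusted hA hF', fun ω => by simp [adjusted], fun τ hτ P hP => ?_⟩
  -- Triviality of `F 0` prevents `τ` from mixing the value 1 at time 0 with values of `A` at later
  -- times.
  have h0 : {ω | τ ω ≤ WithTop.some 0} = ∅ ∨ {ω | τ ω ≤ WithTop.some 0} = Set.univ := by
    have := hτ 0
    rw [hF] at this
    exact MeasurableSpace.measurableSet_bot_iff.1 this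
  rcases h0 with h0 | h0
  · refine le_trans (lintegral_mono fun ω => valueAt_adjusted_le hA e (τ := τ) fun h => ?_)
      ((he.lintegral_evalAt_iSup_le hA hP).trans h)
    have : ω ∈ {ω | τ ω ≤ WithTop.some 0} := h.le
    rw [h0] at this
    exact this
  · have (ω : Ω) : valueAt (adjusted A e) τ ω = 1 := by
      have h1 : ω ∈ {ω | τ ω ≤ WithTop.some 0} := h0 ▸ Set.mem_univ ω
      have h2 : τ ω = WithTop.some 0 := le_antisymm h1 bot_le
      simp only [valueAt]
      rw [h2]
      simp [adjusted]
    simp [this]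

/-- The dominating supermartingale is closed by `A(sup M)`, with initial value reset to 1. -/
theorem IsAdjuster.isAdjusterForTestSupermartingales {A : Set.Ici (1 : ℝ≥0∞) → ℝ≥0∞}
    (hA : Monotone A) (h : IsAdjuster A) : IsAdjusterForTestSupermartingales.{u} A := by
  intro Ω mΩ P G hG M hM
  refine ⟨_, isTestSupermartingale_condLExp hG ((hM.lintegral_evalAt_iSup_le hA).trans h),
    fun t => ?_⟩
  by_cases ht : t = 0
  · refine ae_of_all _ fun ω => ?_
    rw [if_pos ht, ht, runningMax_zero, hM.zero]
    exact (evalAt_one_le_adjusterIntegral hA).trans h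
  · have hself : condLExp (G t) (P : Measure Ω) (fun ω => evalAt A (runningMax M t ω))
        = fun ω => evalAt A (runningMax M t ω) :=
      condLExp_eq_self (G.le t) _ ((measurable_evalAt hA).comp (hM.adapted.runningMax t))
    have hle : (fun ω => evalAt A (runningMax M t ω)) ≤ᵐ[(P : Measure Ω)]
        fun ω => evalAt A (⨆ i, M i ω) :=
      ae_of_all _ fun ω => monotone_evalAt hA (runningMax_le_iSup M t ω)
    have := condLExp_mono (mΩ := G t) hle
    rw [hself] at this
    simpa only [ht, if_false] using! this

theorem LiftsEProcesses.preservesEProcesses {A : Set.Ici (1 : ℝ≥0∞) → ℝ≥0∞}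
    (h : LiftsEProcesses.{u} A) : PreservesEProcesses.{u} A :=
  fun Ω mΩ H G hG e he => h Ω mΩ H G hG e he G hG le_rfl

theorem isEProcess_one {Ω : Type*} {mΩ : MeasurableSpace Ω} (H : Set (ProbabilityMeasure Ω))
    (G : Filtration ℕ mΩ) : IsEProcess H G fun _ _ => 1 where
  adapted _ := measurable_const
  zero_le_one _ := le_rfl
  lintegral_le_one τ _ P _ := by
    have (ω : Ω) : valueAt (fun _ _ => 1) τ ω = 1 := by
      simp only [valueAt]
      cases τ ω <;> simp
    simp [this]

theorem PreservesEProcesses.isAdjusterForEProcesses {A : Set.Ici (1 : ℝ≥0∞) → ℝ≥0∞}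
    (h : PreservesEProcesses.{u} A) : IsAdjusterForEProcesses.{u} A := by
  intro Ω mΩ H G hG e he
  refine ⟨adjusted A e, h Ω mΩ H G hG e he, fun P hP t => ae_of_all _ fun ω => ?_⟩
  by_cases ht : t = 0
  -- The adjusted process is 1 at time 0, so `A(1) ≤ 1` is needed; adjusting the constant e-process
  -- 1 and stopping at time 1 yields it.
  · have h1 := (h Ω mΩ H G hG _ (isEProcess_one H G)).lintegral_le_one (fun _ => WithTop.some 1)
      (isStoppingTime_const G 1) P hP
    have h2 (ω : Ω) : valueAt (adjusted A fun _ _ => 1) (fun _ => WithTop.some 1) ω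
        = evalAt A 1 := by
      simp only [valueAt, adjusted, one_ne_zero, if_false]
      exact evalAt_of_le_one A (iSup₂_le fun _ _ => le_rfl)
    simp only [h2, lintegral_const, measure_univ, mul_one] at h1
    rw [adjusted, if_pos ht, ht, runningMax_zero, evalAt_of_le_one A (he.zero_le_one ω)]
    exact h1
  · rw [adjusted, if_neg ht]

/-! ### Admissible adjusters -/

section Admissible

variable {A B : Set.Ici (1 : ℝ≥0∞) → ℝ≥0∞}

theorem injOn_projIci_ofReal :
    Set.InjOn (fun x : ℝ => Set.projIci (1 : ℝ≥0∞) (ENNReal.ofReal x)) (Set.Ici 1) := by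
  intro x hx y hy hxy
  have hx' : 1 ≤ ENNReal.ofReal x := by simpa using hx
  have hy' : 1 ≤ ENNReal.ofReal y := by simpa using hy
  have := congrArg Subtype.val hxy
  simp only [Set.coe_projIci, max_eq_right hx', max_eq_right hy'] at this
  exact (ENNReal.ofReal_eq_ofReal_iff (zero_le_one.trans hx) (zero_le_one.trans hy)).1 this

theorem adjusterIntegral_congr_of_countable (h : {x | A x ≠ B x}.Countable) :
    adjusterIntegral A = adjusterIntegral B := by
  set φ : ℝ → Set.Ici (1 : ℝ≥0∞) := fun x => Set.projIci 1 (ENNReal.ofReal x)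
  have hc : (φ ⁻¹' {x | A x ≠ B x} ∩ Set.Ici 1).Countable :=
    Set.MapsTo.countable_of_injOn (f := φ) (fun x hx => hx.1)
      (injOn_projIci_ofReal.mono Set.inter_subset_right) h
  refine setLIntegral_congr_fun_ae measurableSet_Ici ?_
  filter_upwards [hc.ae_notMem volume] with x hx hx1
  have : A (φ x) = B (φ x) := not_not.1 fun hne => hx ⟨hne, hx1⟩
  exact congrArg (· / ENNReal.ofReal (x ^ 2)) this

instance : IsProbabilityMeasure invSqMeasure where
  measure_univ := by
    rw [invSqMeasure, withDensity_apply _ MeasurableSet.univ, Measure.restrict_univ,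
      ← setLIntegral_congr Ioi_ae_eq_Ici, lintegral_Ioi_inv_sq one_pos]
    simp

theorem adjusterIntegral_add_const (hA : Monotone A) (c : ℝ≥0∞) :
    adjusterIntegral (fun x => A x + c) = adjusterIntegral A + c := by
  rw [adjusterIntegral_eq_lintegral_invSqMeasure hA,
    adjusterIntegral_eq_lintegral_invSqMeasure (hA.add_const c)]
  have : ∀ x, evalAt (fun x => A x + c) x = evalAt A x + c := fun _ => rfl
  simp only [this]
  rw [lintegral_add_right _ measurable_const]
  simp

theorem countable_setOf_ne_rightLim (hA : Monotone A) :
    {x | A x ≠ Function.rightLim A x}.Countable := by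
  refine hA.countable_not_continuousAt.mono fun x hx (hcont : ContinuousAt A x) => hx ?_
  exact (hA.continuousWithinAt_Ioi_iff_rightLim_eq.1 hcont.continuousWithinAt).symm

/-- If `A ≤ B` have the same finite integral, then `B x ≤ A y` whenever `x < y < ∞`. -/
theorem le_of_adjusterIntegral_le (hA : Monotone A) (hB : Monotone B) (hAB : ∀ x, A x ≤ B x)
    (hfin : adjusterIntegral A ≠ ⊤) (hle : adjusterIntegral B ≤ adjusterIntegral A)
    {x y : Set.Ici (1 : ℝ≥0∞)} (hxy : x < y) (hy : y.1 ≠ ⊤) : B x ≤ A y := by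
  rw [adjusterIntegral_eq_lintegral_invSqMeasure hA] at hfin hle
  rw [adjusterIntegral_eq_lintegral_invSqMeasure hB] at hle
  have hae := ae_eq_of_ae_le_of_lintegral_le (ae_of_all _ fun x => hAB _) hfin
    (measurable_evalAt_ofReal hB).aemeasurable hle
  by_contra! hlt
  have hx : x.1 ≠ ⊤ := ((Subtype.coe_lt_coe.2 hxy).trans_le le_top).ne
  have hx1 : 1 ≤ x.1.toReal := by simpa using ENNReal.toReal_mono hx x.2
  have hxy' : x.1.toReal < y.1.toReal := (ENNReal.toReal_lt_toReal hx hy).2 hxy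
  -- If `A y < B x`, monotonicity separates `A` from `B` on all of `(x, y]`, an interval of positive
  -- mass `1/x - 1/y`.
  have hnull : invSqMeasure (Set.Ioc x.1.toReal y.1.toReal) = 0 := by
    refine measure_mono_null (fun z hz => ?_) (ae_iff.1 hae)
    refine ne_of_lt ?_
    calc evalAt A (ENNReal.ofReal z) ≤ evalAt A y.1 :=
          monotone_evalAt hA (ENNReal.ofReal_le_of_le_toReal hz.2)
      _ = A y := evalAt_coe A y
      _ < B x := hlt
      _ = evalAt B x.1 := (evalAt_coe B x).symm
      _ ≤ evalAt B (ENNReal.ofReal z) :=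
          monotone_evalAt hB ((ENNReal.le_ofReal_iff_toReal_le hx (by linarith [hz.1])).2 hz.1.le)
  have h := measure_union_le (μ := invSqMeasure) (Set.Ioc x.1.toReal y.1.toReal)
    (Set.Ioi y.1.toReal)
  rw [Set.Ioc_union_Ioi_eq_Ioi hxy'.le, hnull, zero_add, invSqMeasure_Ioi hx1,
    invSqMeasure_Ioi (hx1.trans hxy'.le), ENNReal.inv_le_inv, ENNReal.ofReal_toReal hx,
    ENNReal.ofReal_toReal hy] at h
  exact (not_le.2 hxy) h

theorem isAdmissible_isAdjuster_iff (hA : Monotone A) :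
    IsAdmissible IsAdjuster A ↔
      (∀ x, ContinuousWithinAt A (Set.Ici x) x) ∧ A ⟨⊤, Set.mem_Ici.mpr le_top⟩ = ⊤ ∧
        adjusterIntegral A = 1 := by
  constructor
  · rintro ⟨-, hint, hmax⟩
    refine ⟨fun x => ?_, ?_, ?_⟩
    · have h := hmax (Function.rightLim A) hA.rightLim
        ((adjusterIntegral_congr_of_countable (countable_setOf_ne_rightLim hA)).symm.trans_le hint)
        fun x => hA.le_rightLim le_rfl
      rw [← h]
      exact continuousWithinAt_rightLim_Ici (hA.tendsto_rightLim x)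
    · have h := hmax (Function.update A ⟨⊤, Set.mem_Ici.mpr le_top⟩ ⊤) ?_ ?_ ?_
      · rw [← h]
        simp
      · intro x y hxy
        rcases eq_or_ne y ⟨⊤, Set.mem_Ici.mpr le_top⟩ with rfl | hy
        · simp
        · have hx : x ≠ ⟨⊤, Set.mem_Ici.mpr le_top⟩ := by
            rintro rfl
            exact hy (le_antisymm (Subtype.coe_le_coe.1 le_top) hxy)
          rw [Function.update_of_ne hx, Function.update_of_ne hy]
          exact hA hxy
      · refine (adjusterIntegral_congr_of_countable ?_).trans_le hint
        refine (Set.countable_singleton (⟨⊤, Set.mem_Ici.mpr le_top⟩ : Set.Ici (1 : ℝ≥0∞))).mono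
          fun x hx => ?_
        by_contra hne
        exact hx (Function.update_of_ne hne _ _)
      · exact fun x => le_update_iff.2 ⟨le_top, fun _ _ => le_rfl⟩ x
    -- `invSqMeasure` is a probability measure, so adding the deficit as a constant brings the
    -- integral to exactly 1.
    · have h := hmax (fun x => A x + (1 - adjusterIntegral A)) (hA.add_const _) ?_
        fun x => le_self_add
      · have h1 := congrArg adjusterIntegral h
        rw [adjusterIntegral_add_const hA, add_tsub_cancel_of_le hint] at h1
        exact h1.symm
      · rw [IsAdjuster, adjusterIntegral_add_const hA, add_tsub_cancel_of_le hint]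
  · rintro ⟨hcont, htop, hint⟩
    refine ⟨hA, hint.le, fun B hB hBint hAB => funext fun x => le_antisymm ?_ (hAB x)⟩
    rcases eq_or_ne x.1 ⊤ with hx | hx
    · obtain rfl : x = ⟨⊤, Set.mem_Ici.mpr le_top⟩ := Subtype.ext hx
      rw [htop]
      exact le_top
    have hlt : x < ⟨⊤, Set.mem_Ici.mpr le_top⟩ := Subtype.coe_lt_coe.1 (lt_top_iff_ne_top.2 hx)
    have : (nhdsWithin x (Set.Ioi x)).NeBot := nhdsGT_neBot_of_exists_gt ⟨_, hlt⟩
    -- It suffices that `B x ≤ A y` for all `y > x`: letting `y` decrease to `x`, right-continuity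
    -- gives `B x ≤ A x`.
    refine ge_of_tendsto ((hcont x).mono Set.Ioi_subset_Ici_self) ?_
    filter_upwards [self_mem_nhdsWithin] with y hy
    rcases eq_or_ne y.1 ⊤ with hyt | hyt
    · obtain rfl : y = ⟨⊤, Set.mem_Ici.mpr le_top⟩ := Subtype.ext hyt
      rw [htop]
      exact le_top
    · exact le_of_adjusterIntegral_le hA hB hAB (by simp [hint]) (hint ▸ hBint) hy hyt

theorem IsAdmissible.congr {Q R : (Set.Ici (1 : ℝ≥0∞) → ℝ≥0∞) → Prop}
    (h : ∀ A, Monotone A → (Q A ↔ R A)) : IsAdmissible Q A ↔ IsAdmissible R A := by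
  unfold IsAdmissible
  refine and_congr_right fun hA => and_congr (h A hA) (forall_congr' fun B => ?_)
  exact forall_congr' fun hB => by rw [h B hB]

end Admissible

/-! ### Necessity: all-in betting -/

/-- Ruin on every path makes the limsup at infinite times 0, so Fatou's lemma along `min n τ`
suffices and no convergence theorem is needed. -/
theorem IsTestSupermartingale.isEProcess_of_eventually_eq_zero {Ω : Type*}
    {mΩ : MeasurableSpace Ω} {P : ProbabilityMeasure Ω} {G : Filtration ℕ mΩ}
    {M : ℕ → Ω → ℝ≥0∞} (hM : IsTestSupermartingale P G M)
    (h0 : ∀ ω, ∀ᶠ t in atTop, M t ω = 0) : IsEProcess {P} G M where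
  adapted := hM.adapted
  zero_le_one ω := (hM.zero ω).le
  lintegral_le_one τ hτ Q hQ := by
    obtain rfl : Q = P := hQ
    have hmeas (n : ℕ) : Measurable (stoppedProcess M τ n) :=
      (StronglyAdapted.stronglyMeasurable_stoppedProcess_of_discrete
        (fun t => (hM.adapted t).stronglyMeasurable) hτ n).measurable
    have hle (ω : Ω) : valueAt M τ ω ≤ liminf (fun n => stoppedProcess M τ n ω) atTop := by
      simp only [valueAt]
      cases hω : τ ω with
      | top =>
        have : Tendsto (fun t => M t ω) atTop (nhds 0) :=
          tendsto_const_nhds.congr' ((h0 ω).mono fun t ht => ht.symm)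
        simp [this.limsup_eq]
      | coe k =>
        refine le_liminf_of_le (by isBoundedDefault) ?_
        filter_upwards [eventually_ge_atTop k] with n hn
        have : τ ω ≤ WithTop.some n := hω ▸ WithTop.coe_le_coe.2 hn
        rw [stoppedProcess_eq_of_ge this, hω]
        exact le_rfl
    calc ∫⁻ ω, valueAt M τ ω ∂(Q : Measure Ω)
        ≤ ∫⁻ ω, liminf (fun n => stoppedProcess M τ n ω) atTop ∂(Q : Measure Ω) :=
          lintegral_mono hle
      _ ≤ liminf (fun n => ∫⁻ ω, stoppedProcess M τ n ω ∂(Q : Measure Ω)) atTop :=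
          lintegral_liminf_le hmeas
      _ ≤ 1 := liminf_le_of_le (by isBoundedDefault) fun b hb => by
          obtain ⟨n, hn⟩ := hb.exists
          exact hn.trans (hM.lintegral_stoppedProcess_le_one hτ n)

section Doubling

open ProbabilityTheory

theorem geometricMeasure_setOf_le {p : unitInterval} (hp : p ≠ 0) (t : ℕ) :
    geometricMeasure p {k | t ≤ k} = ENNReal.ofReal ((1 - p) ^ t) := by
  have hq : 0 ≤ 1 - (p : ℝ) := sub_nonneg.2 p.2.2
  induction t with
  | zero => simp
  | succ t ih =>
    have hset : {k | t ≤ k} = {t} ∪ {k | t + 1 ≤ k} := by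
      ext k
      simp only [Set.mem_ofPred_eq, Set.mem_union, Set.mem_singleton_iff]
      omega
    rw [hset, measure_union (by simp) (MeasurableSet.of_discrete),
      geometricMeasure_singleton hp] at ih
    have hsum : ENNReal.ofReal ((1 - p) ^ t) = ENNReal.ofReal ((1 - p) ^ t * p)
        + ENNReal.ofReal ((1 - p) ^ (t + 1)) := by
      rw [← ENNReal.ofReal_add (geometricMeasure_nonneg p t) (by positivity)]
      congr 1
      ring
    rw [hsum] at ih
    exact (ENNReal.add_right_inj ENNReal.ofReal_ne_top).1 ih

instance : DiscreteMeasurableSpace (ULift.{u} ℕ) where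
  forall_measurableSet s :=
    measurable_down (MeasurableSet.of_discrete (s := ULift.up ⁻¹' s))

/-- The geometric distribution on a copy of `ℕ` in an arbitrary universe. -/
noncomputable def geometricULift (p : unitInterval) : ProbabilityMeasure (ULift.{u} ℕ) :=
  ⟨(geometricMeasure p).map ULift.up, Measure.isProbabilityMeasure_map (by fun_prop)⟩

theorem lintegral_geometricULift (p : unitInterval) (f : ULift.{u} ℕ → ℝ≥0∞) :
    ∫⁻ ω, f ω ∂(geometricULift p : Measure (ULift.{u} ℕ))
      = ∫⁻ k, f ⟨k⟩ ∂geometricMeasure p :=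
  lintegral_map (.of_discrete) (.of_discrete)

/-- At time `t` one knows `min ω t`: either the value `ω < t`, or that `t ≤ ω`. -/
def minFiltration : Filtration ℕ (inferInstance : MeasurableSpace (ULift.{u} ℕ)) where
  seq t := MeasurableSpace.comap (fun ω => min ω.down t) ⊤
  mono' s t hst := by
    rintro _ ⟨B, -, rfl⟩
    refine ⟨(fun k => min k s) ⁻¹' B, trivial, ?_⟩
    ext ω
    simp only [Set.mem_preimage, min_assoc, min_eq_right hst]
  le' _ _ _ := .of_discrete

theorem minFiltration_zero : minFiltration.{u} 0 = ⊥ := by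
  have : (fun ω : ULift.{u} ℕ => min ω.down 0) = fun _ => 0 := funext fun _ => by simp
  change MeasurableSpace.comap (fun ω : ULift.{u} ℕ => min ω.down 0) ⊤ = ⊥
  rw [this, MeasurableSpace.comap_const]

/-- The wealth of a gambler who stakes everything in each of a sequence of fair bets won with
probability `q`, when the first `ω` bets are won. -/
noncomputable def allIn (q : ℝ) (t : ℕ) (ω : ULift.{u} ℕ) : ℝ≥0∞ :=
  if t ≤ ω.down then (ENNReal.ofReal (q ^ t))⁻¹ else 0

variable {p : unitInterval}

theorem lintegral_allIn (hp0 : p ≠ 0) (hp1 : p ≠ 1) (t : ℕ) :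
    ∫⁻ ω, allIn.{u} (1 - p) t ω ∂(geometricULift p : Measure (ULift.{u} ℕ)) = 1 := by
  have hq : 0 < 1 - (p : ℝ) := sub_pos.2 (unitInterval.lt_one_iff_ne_one.2 hp1)
  rw [lintegral_geometricULift]
  have : (fun k : ℕ => allIn.{u} (1 - p) t ⟨k⟩)
      = {k | t ≤ k}.indicator fun _ => (ENNReal.ofReal ((1 - p : ℝ) ^ t))⁻¹ := by
    ext k
    simp [allIn, Set.indicator_apply]
  rw [this, lintegral_indicator_const .of_discrete, geometricMeasure_setOf_le hp0]
  exact ENNReal.inv_mul_cancel (by simpa using pow_pos hq t) ENNReal.ofReal_ne_top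

theorem isTestSupermartingale_allIn (hp0 : p ≠ 0) (hp1 : p ≠ 1) :
    IsTestSupermartingale (geometricULift.{u} p) minFiltration (allIn (1 - p)) := by
  have hadapted : Adapted minFiltration.{u} (allIn (1 - p)) := by
    intro t B _
    refine ⟨(fun k : ℕ => if t ≤ k then (ENNReal.ofReal ((1 - p : ℝ) ^ t))⁻¹ else 0) ⁻¹' B,
      trivial, ?_⟩
    ext ω
    simp [allIn]
  refine ⟨hadapted, fun ω => by simp [allIn], fun t => ?_⟩
  rw [condLExp_le_iff (minFiltration.le t) (hadapted t)]
  rintro _ ⟨B, -, rfl⟩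
  set s : Set (ULift.{u} ℕ) := (fun ω => min ω.down t) ⁻¹' B
  -- `{t ≤ ω}` is an atom of the filtration at time `t`. Either `s` contains it, and with it all the
  -- wealth at time `t`, or `s` misses it, and the wealth at time `t + 1` vanishes on `s`.
  by_cases ht : t ∈ B
  · have hts (ω : ULift.{u} ℕ) (hω : ω ∉ s) : allIn (1 - p) t ω = 0 := by
      refine if_neg fun h => hω ?_
      change min ω.down t ∈ B
      rwa [min_eq_right h]
    calc ∫⁻ ω in s, allIn (1 - p) (t + 1) ω ∂(geometricULift p : Measure (ULift.{u} ℕ))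
        ≤ ∫⁻ ω, allIn (1 - p) (t + 1) ω ∂(geometricULift p : Measure (ULift.{u} ℕ)) :=
          setLIntegral_le_lintegral _ _
      _ = ∫⁻ ω, allIn (1 - p) t ω ∂(geometricULift p : Measure (ULift.{u} ℕ)) := by
          rw [lintegral_allIn hp0 hp1, lintegral_allIn hp0 hp1]
      _ = ∫⁻ ω in s, allIn (1 - p) t ω ∂(geometricULift p : Measure (ULift.{u} ℕ)) := by
          rw [← lintegral_indicator .of_discrete]
          congr 1
          ext ω
          by_cases hω : ω ∈ s
          · rw [Set.indicator_of_mem hω]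
          · rw [Set.indicator_of_notMem hω, hts ω hω]
  · refine setLIntegral_mono' .of_discrete fun ω hω => ?_
    have : ¬ t + 1 ≤ ω.down := fun h => ht (by
      have h1 : min ω.down t ∈ B := hω
      rwa [min_eq_right (by omega)] at h1)
    rw [allIn, if_neg this]
    exact bot_le

theorem isEProcess_allIn (hp0 : p ≠ 0) (hp1 : p ≠ 1) :
    IsEProcess {geometricULift.{u} p} minFiltration (allIn (1 - p)) := by
  refine (isTestSupermartingale_allIn hp0 hp1).isEProcess_of_eventually_eq_zero fun ω => ?_
  filter_upwards [eventually_gt_atTop ω.down] with t ht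
  exact if_neg (by omega)

/-- On `{ω = k}` the wealth has reached `(1 - p)⁻ᵏ` by time `k`, so the expectation at time `n`
dominates the first `n` terms. -/
theorem tsum_le_one_of_lintegral_allIn_le {A : Set.Ici (1 : ℝ≥0∞) → ℝ≥0∞} (hA : Monotone A)
    (hp0 : p ≠ 0)
    (h : ∀ t, ∫⁻ ω, evalAt A (runningMax (allIn.{u} (1 - p)) t ω)
      ∂(geometricULift p : Measure (ULift.{u} ℕ)) ≤ 1) :
    ∑' k : ℕ, evalAt A (ENNReal.ofReal ((1 - p : ℝ) ^ k))⁻¹ *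
      ENNReal.ofReal ((1 - p) ^ k * p) ≤ 1 := by
  refine ENNReal.tsum_le_of_sum_range_le fun n => (le_trans ?_ (h n))
  rw [lintegral_geometricULift]
  refine le_trans ?_ (setLIntegral_le_lintegral (Finset.range n : Set ℕ) _)
  rw [lintegral_finset]
  refine Finset.sum_le_sum fun k hk => ?_
  rw [geometricMeasure_singleton hp0]
  gcongr
  refine monotone_evalAt hA ?_
  refine le_trans ?_ (le_iSup₂ (f := fun i (_ : i ≤ n) => allIn (1 - p : ℝ) i ⟨k⟩) k
    (Finset.mem_range.1 hk).le)
  simp [allIn]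

end Doubling

/-- An upper Riemann sum on the grid `q⁻ᵏ`: on each cell, `A` is taken at the right end and `1 / x²`
at the left end. This costs the factor `q⁻²` relative to the term of index `k + 1`. -/
theorem adjusterIntegral_le_of_tsum_le {A : Set.Ici (1 : ℝ≥0∞) → ℝ≥0∞} (hA : Monotone A) {q : ℝ}
    (hq0 : 0 < q) (hq1 : q < 1)
    (h : ∑' k : ℕ, evalAt A (ENNReal.ofReal (q ^ k))⁻¹ *
      ENNReal.ofReal (q ^ k * (1 - q)) ≤ 1) :
    adjusterIntegral A ≤ ENNReal.ofReal ((q ^ 2)⁻¹) := by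
  have hcover : Set.Ici (1 : ℝ) ⊆ ⋃ k : ℕ, Set.Ico ((q ^ k)⁻¹) ((q ^ (k + 1))⁻¹) := by
    intro x hx
    obtain ⟨k, hk⟩ := exists_nat_pow_near hx (one_lt_inv₀ hq0 |>.2 hq1)
    simp only [inv_pow] at hk
    exact Set.mem_iUnion.2 ⟨k, hk⟩
  have hpiece (k : ℕ) : ∫⁻ x in Set.Ico ((q ^ k)⁻¹) ((q ^ (k + 1))⁻¹),
      evalAt A (ENNReal.ofReal x) / ENNReal.ofReal (x ^ 2) ≤
      ENNReal.ofReal ((q ^ 2)⁻¹) * (evalAt A (ENNReal.ofReal (q ^ (k + 1)))⁻¹ *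
        ENNReal.ofReal (q ^ (k + 1) * (1 - q))) := by
    have hqk : 0 < q ^ k := by positivity
    calc ∫⁻ x in Set.Ico ((q ^ k)⁻¹) ((q ^ (k + 1))⁻¹),
          evalAt A (ENNReal.ofReal x) / ENNReal.ofReal (x ^ 2)
        ≤ ∫⁻ _ in Set.Ico ((q ^ k)⁻¹) ((q ^ (k + 1))⁻¹),
          evalAt A (ENNReal.ofReal (q ^ (k + 1)))⁻¹ * ENNReal.ofReal ((q ^ k) ^ 2) := by
          refine setLIntegral_mono' measurableSet_Ico fun x hx => ?_
          have hx0 : 0 < x := (inv_pos.2 hqk).trans_le hx.1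
          rw [div_eq_mul_inv]
          refine mul_le_mul' (monotone_evalAt hA ?_) ?_
          · rw [← ENNReal.ofReal_inv_of_pos (by positivity)]
            exact ENNReal.ofReal_le_ofReal hx.2.le
          · rw [← ENNReal.ofReal_inv_of_pos (by positivity), ← inv_pow]
            refine ENNReal.ofReal_le_ofReal (pow_le_pow_left₀ (by positivity) ?_ 2)
            exact inv_le_of_inv_le₀ hqk hx.1
      _ = evalAt A (ENNReal.ofReal (q ^ (k + 1)))⁻¹ * (ENNReal.ofReal ((q ^ k) ^ 2) *
          ENNReal.ofReal ((q ^ (k + 1))⁻¹ - (q ^ k)⁻¹)) := by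
          rw [setLIntegral_const, Real.volume_Ico, mul_assoc]
      _ = _ := by
          rw [mul_left_comm (ENNReal.ofReal ((q ^ 2)⁻¹)), ← ENNReal.ofReal_mul (by positivity),
            ← ENNReal.ofReal_mul (by positivity)]
          congr 2
          field_simp
          ring
  calc adjusterIntegral A
      ≤ ∫⁻ x in ⋃ k : ℕ, Set.Ico ((q ^ k)⁻¹) ((q ^ (k + 1))⁻¹),
        evalAt A (ENNReal.ofReal x) / ENNReal.ofReal (x ^ 2) := lintegral_mono_set hcover
    _ ≤ ∑' k : ℕ, ∫⁻ x in Set.Ico ((q ^ k)⁻¹) ((q ^ (k + 1))⁻¹),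
        evalAt A (ENNReal.ofReal x) / ENNReal.ofReal (x ^ 2) := lintegral_iUnion_le _ _
    _ ≤ ∑' k : ℕ, ENNReal.ofReal ((q ^ 2)⁻¹) * (evalAt A (ENNReal.ofReal (q ^ (k + 1)))⁻¹ *
        ENNReal.ofReal (q ^ (k + 1) * (1 - q))) := ENNReal.tsum_le_tsum hpiece
    _ = ENNReal.ofReal ((q ^ 2)⁻¹) * ∑' k : ℕ, (evalAt A (ENNReal.ofReal (q ^ (k + 1)))⁻¹ *
        ENNReal.ofReal (q ^ (k + 1) * (1 - q))) := ENNReal.tsum_mul_left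
    _ ≤ ENNReal.ofReal ((q ^ 2)⁻¹) * 1 := by
        gcongr
        exact (ENNReal.tsum_comp_le_tsum_of_injective (add_left_injective 1)
          fun k => evalAt A (ENNReal.ofReal (q ^ k))⁻¹ *
            ENNReal.ofReal (q ^ k * (1 - q))).trans h
    _ = _ := mul_one _

theorem isAdjuster_of_forall_lintegral_allIn_le {A : Set.Ici (1 : ℝ≥0∞) → ℝ≥0∞} (hA : Monotone A)
    (h : ∀ p : unitInterval, p ≠ 0 → p ≠ 1 → ∀ t,
      ∫⁻ ω, evalAt A (runningMax (allIn.{u} (1 - p)) t ω)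
        ∂(geometricULift p : Measure (ULift.{u} ℕ)) ≤ 1) :
    IsAdjuster A := by
  have hbound (q : ℝ) (hq : q ∈ Set.Ioo (0 : ℝ) 1) :
      adjusterIntegral A ≤ ENNReal.ofReal ((q ^ 2)⁻¹) := by
    -- The success parameter of the geometric law is the probability `1 - q` of losing a bet.
    set p : unitInterval := ⟨1 - q, sub_nonneg.2 hq.2.le, sub_le_self 1 hq.1.le⟩
    have hpq : 1 - (p : ℝ) = q := sub_sub_cancel 1 q
    have hp0 : p ≠ 0 := fun h0 => (sub_pos.2 hq.2).ne' (congrArg Subtype.val h0)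
    have hp1 : p ≠ 1 := fun h1 => hq.1.ne' (by
      rw [← hpq, h1]
      simp)
    refine adjusterIntegral_le_of_tsum_le hA hq.1 hq.2 ?_
    have := tsum_le_one_of_lintegral_allIn_le hA hp0 (h p hp0 hp1)
    rwa [hpq] at this
  have hlim : Tendsto (fun q : ℝ => ENNReal.ofReal ((q ^ 2)⁻¹)) (nhdsWithin 1 (Set.Iio 1))
      (nhds 1) := by
    have : ContinuousAt (fun q : ℝ => ENNReal.ofReal ((q ^ 2)⁻¹)) 1 :=
      ENNReal.continuous_ofReal.continuousAt.comp
        ((continuousAt_id.pow 2).inv₀ (by norm_num))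
    simpa [ContinuousAt] using this.tendsto.mono_left nhdsWithin_le_nhds
  refine ge_of_tendsto hlim ?_
  filter_upwards [Ioo_mem_nhdsLT (zero_lt_one' ℝ)] with q hq using hbound q hq

theorem IsAdjusterForTestSupermartingales.isAdjuster {A : Set.Ici (1 : ℝ≥0∞) → ℝ≥0∞}
    (hA : Monotone A) (h : IsAdjusterForTestSupermartingales.{u} A) : IsAdjuster A := by
  refine isAdjuster_of_forall_lintegral_allIn_le.{u} hA fun p hp0 hp1 t => ?_
  obtain ⟨M', hM', hle⟩ := h _ _ _ _ minFiltration_zero _ (isTestSupermartingale_allIn hp0 hp1)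
  -- Optional sampling at the constant time `t` gives `E[M'_t] ≤ 1`.
  have := hM'.lintegral_stoppedProcess_le_one (τ := fun _ => WithTop.some t)
    (isStoppingTime_const _ t) t
  have heq : stoppedProcess M' (fun _ => WithTop.some t) t = M' t :=
    funext fun _ => stoppedProcess_eq_of_le le_rfl
  rw [heq] at this
  exact (lintegral_mono_ae (hle t)).trans this

theorem IsAdjusterForEProcesses.isAdjuster {A : Set.Ici (1 : ℝ≥0∞) → ℝ≥0∞}
    (hA : Monotone A) (h : IsAdjusterForEProcesses.{u} A) : IsAdjuster A := by
  refine isAdjuster_of_forall_lintegral_allIn_le.{u} hA fun p hp0 hp1 t => ?_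
  obtain ⟨e', he', hle⟩ := h _ _ _ _ minFiltration_zero _ (isEProcess_allIn hp0 hp1)
  exact (lintegral_mono_ae (hle _ rfl t)).trans
    (he'.lintegral_le_one _ (isStoppingTime_const _ t) _ rfl)

theorem tfae_isAdjuster {A : Set.Ici (1 : ℝ≥0∞) → ℝ≥0∞} (hA : Monotone A) :
    List.TFAE
      [IsAdjuster A, IsAdjusterForTestSupermartingales.{u} A, IsAdjusterForEProcesses.{u} A,
        PreservesEProcesses.{u} A, LiftsEProcesses.{u} A] := by
  tfae_have 1 → 2 := IsAdjuster.isAdjusterForTestSupermartingales hA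
  tfae_have 2 → 1 := IsAdjusterForTestSupermartingales.isAdjuster hA
  tfae_have 1 → 5 := IsAdjuster.liftsEProcesses hA
  tfae_have 5 → 4 := LiftsEProcesses.preservesEProcesses
  tfae_have 4 → 3 := PreservesEProcesses.isAdjusterForEProcesses
  tfae_have 3 → 1 := IsAdjusterForEProcesses.isAdjuster hA
  tfae_finish

end Adjuster

theorem theorem3 (A : Set.Ici (1 : ℝ≥0∞) → ℝ≥0∞) (hA : Monotone A) :
    List.TFAE
      [Adjuster.IsAdjuster A,
        Adjuster.IsAdjusterForTestSupermartingales.{u} A,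
        Adjuster.IsAdjusterForEProcesses.{u} A,
        Adjuster.PreservesEProcesses.{u} A,
        Adjuster.LiftsEProcesses.{u} A] ∧
    ∀ Q ∈ ([Adjuster.IsAdjuster,
        Adjuster.IsAdjusterForTestSupermartingales.{u},
        Adjuster.IsAdjusterForEProcesses.{u},
        Adjuster.PreservesEProcesses.{u},
        Adjuster.LiftsEProcesses.{u}] : List ((Set.Ici (1 : ℝ≥0∞) → ℝ≥0∞) → Prop)),
      (Adjuster.IsAdmissible Q A ↔
        (∀ x, ContinuousWithinAt A (Set.Ici x) x) ∧
        A ⟨⊤, Set.mem_Ici.mpr le_top⟩ = ⊤ ∧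
        Adjuster.adjusterIntegral A = 1) := by
  refine ⟨Adjuster.tfae_isAdjuster hA, fun Q hQ => ?_⟩
  have hQ' : ∀ B, Monotone B → (Q B ↔ Adjuster.IsAdjuster B) := by
    intro B hB
    have htfae := Adjuster.tfae_isAdjuster.{u} hB
    simp only [List.mem_cons, List.not_mem_nil, or_false] at hQ
    rcases hQ with rfl | rfl | rfl | rfl | rfl
    · exact Iff.rfl
    · exact htfae.out 1 0
    · exact htfae.out 2 0
    · exact htfae.out 3 0
    · exact htfae.out 4 0
  rw [Adjuster.IsAdmissible.congr hQ', Adjuster.isAdmissible_isAdjuster_iff hA]
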